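/- **Theorem.** Multigraphs are finite and may have loops and parallel edges. An edge-coloured multigraph $G$ is called *simple* if no colour class (the set of all edges of one given colour) contains two parallel edges, i.e. two distinct edges with the same ends. A *cycle of length* $k\ge 1$ consists of $k$ distinct vertices $v_0,\dots,v_{k-1}$ and $k$ distinct edges $e_0,\dots,e_{k-1}$ such that $e_i$ has ends $v_i$ and $v_{i+1}$ (indices modulo $k$), so a loop is a cycle of length $1$ and a pair of parallel edges forms a cycle of length $2$. A cycle is *rainbow* if no two of its edges have the same colour. Let $n\ge 1$ and let $G$ be a simple edge-coloured multigraph with $n$ vertices and at least $n$ colours (in particular, with exactly $n$ colours), in which every colour class has at least $3$ edges. Then $G$ contains a rainbow cycle of length at most $\frac{4n}{9}+7$. -/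

import Mathlib

/-!
Multigraphs are Mathlib's `Graph α β`: parallel edges and loops are allowed. An edge-colouring of
`G` is a map `c : β → γ` on the ambient type of edges; only its values on the edge set of `G` are
ever used.
-/

namespace Graph

variable {α β γ : Type*}

/-- The colour class of the colour `i`: the set of all edges of `G` that have colour `i`. -/
def colourClass (G : Graph α β) (c : β → γ) (i : γ) : Set β :=
  {e | e ∈ G.edgeSet ∧ c e = i}

/-- An edge-coloured multigraph is simple if no colour class contains two parallel edges, i.e. two
distinct edges with the same ends. (Two loops at the same vertex are parallel; parallel edges of
different colours are allowed.) -/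
def IsSimpleEdgeColoured (G : Graph α β) (c : β → γ) : Prop :=
  ∀ i : γ, ∀ e ∈ G.colourClass c i, ∀ f ∈ G.colourClass c i, ∀ x y : α,
    G.IsLink e x y → G.IsLink f x y → e = f

/-- A set of edges is rainbow if no two of its members have the same colour. -/
def IsRainbow (c : β → γ) (F : Set β) : Prop :=
  Set.InjOn c F

/-- The distinct vertices `v 0, …, v (k - 1)` and the distinct edges `e 0, …, e (k - 1)` of `G`
form a cycle of length `k ≥ 1`: the ends of `e i` are `v i` and its cyclic successor `v (i + 1)`,
indices being taken modulo `k`. For `k = 1` this is a loop, for `k = 2` a pair of parallel edges. -/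
structure IsCycle (G : Graph α β) (k : ℕ) (v : Fin k → α) (e : Fin k → β) : Prop where
  one_le : 1 ≤ k
  vertex_injective : Function.Injective v
  edge_injective : Function.Injective e
  isLink : ∀ i : Fin k, G.IsLink (e i) (v i) (v (finRotate k i))

/-- `G` contains a rainbow cycle of length `k`. -/
def HasRainbowCycle (G : Graph α β) (c : β → γ) (k : ℕ) : Prop :=
  ∃ (v : Fin k → α) (e : Fin k → β), G.IsCycle k v e ∧ IsRainbow c (Set.range e)

end Graph

/-! A loop is itself a short rainbow cycle. Without loops, keep `n` colours and three edges of each.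
A transversal (one edge per colour) is a multigraph all of whose cycles are rainbow, so short cycles
in well-chosen transversals are wanted.

A vertex set `W` kills a colour if all three edges meet `W`; the deficiency of `W` is `#W` minus the
number of killed colours. A transversal of the surviving colours that avoids `W` has that many more
edges than the complement of `W` has vertices. Averaging over even edge sets gives a cycle using at
most 2/3 of the edges when the excess is 1, and 4/7 when it is 2 (`exists_cycle_of_card_add_one_le`,
`exists_cycle_of_card_add_two_le`). This is good when `W` is large. If `W` is maximal for its
deficiency, double counting (`mul_card_compl_le`) shows that almost all surviving colours have a
single edge off `W`. Another transversal then has almost all edges meeting `W`, and its sparse core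
(`exists_sparse_core`) has only about `2 * #W` edges. This is good when `W` is small.

The argument applies if some deficiency is at least 2, or if all are at most 1 and some vertex kills
no colour. Otherwise every vertex is the centre of a star-shaped class, and orienting the stars
outwards gives a digraph with out-degrees at least 3, handled by induction in
`exists_short_closed_diwalk`. -/

/-! ### Cycles in multigraphs. -/

section Multigraph

open Finset

variable {V C : Type*} [DecidableEq V] [DecidableEq C]

/-- The multigraph with edge set `F`, in which the edge `e` has the ends `t e`, contains a cycle
of length `k`. -/
def HasCycleIn (t : C → Sym2 V) (F : Finset C) (k : ℕ) : Prop :=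
  ∃ (v : Fin k → V) (c : Fin k → C), 1 ≤ k ∧ Function.Injective v ∧ Function.Injective c ∧
    ∀ i, c i ∈ F ∧ t (c i) = s(v i, v (finRotate k i))

omit [DecidableEq V] [DecidableEq C] in
theorem HasCycleIn.mono {t : C → Sym2 V} {F F' : Finset C} {k : ℕ} (h : HasCycleIn t F k)
    (hF : F ⊆ F') : HasCycleIn t F' k := by
  obtain ⟨v, c, h1, h2, h3, h4⟩ := h
  exact ⟨v, c, h1, h2, h3, fun i => ⟨hF (h4 i).1, (h4 i).2⟩⟩

omit [DecidableEq V] [DecidableEq C] in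
theorem HasCycleIn.le_card {t : C → Sym2 V} {F : Finset C} {k : ℕ} (h : HasCycleIn t F k) :
    k ≤ #F := by
  obtain ⟨v, c, h1, h2, h3, h4⟩ := h
  simpa using Finset.card_le_card_of_injOn (s := univ) (t := F) c (fun i _ => (h4 i).1) h3.injOn

omit [DecidableEq V] [DecidableEq C] in
theorem HasCycleIn.le_card_vertices {t : C → Sym2 V} {F : Finset C} {k : ℕ}
    (h : HasCycleIn t F k) {X : Finset V} (hX : ∀ e ∈ F, ∀ x ∈ t e, x ∈ X) : k ≤ #X := by
  obtain ⟨v, c, h1, h2, h3, h4⟩ := h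
  simpa using Finset.card_le_card_of_injOn (s := univ) (t := X) v
    (fun i _ => hX _ (h4 i).1 _ (by rw [(h4 i).2]; simp)) h2.injOn

/-- A segment of a non-backtracking walk that runs from a vertex back to it is a cycle if its
vertices are distinct. -/
theorem exists_cycle_of_walk {V C : Type*} [Finite V] {t : C → Sym2 V} {F : Finset C}
    (x : ℕ → V) (e : ℕ → C) (heF : ∀ i, e i ∈ F) (hx : ∀ i, t (e i) = s(x i, x (i + 1)))
    (he : ∀ i, e (i + 1) ≠ e i) : ∃ k, HasCycleIn t F k := by
  classical
  have hex : ∃ j, ∃ i < j, x i = x j := by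
    obtain ⟨i, j, hij, h⟩ := Finite.exists_ne_map_eq_of_infinite x
    rcases lt_or_gt_of_ne hij with h' | h'
    · exact ⟨j, i, h', h⟩
    · exact ⟨i, j, h', h.symm⟩
  obtain ⟨i, hi, hxi⟩ := Nat.find_spec hex
  set j := Nat.find hex with hj
  have hinj : ∀ a b, a < b → b < j → x a ≠ x b := fun a b hab hb h =>
    Nat.find_min hex hb ⟨a, hab, h⟩
  -- Since the vertices before the first repetition differ, a repeated edge is traversed in opposite
  -- directions at consecutive steps, which `he` forbids.
  have heinj : ∀ a b, i ≤ a → a < b → b < j → e a ≠ e b := by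
    intro a b hia hab hb h
    have h1 := hx a
    rw [h, hx b, Sym2.eq_iff] at h1
    rcases h1 with h1 | h1
    · exact hinj a b hab hb h1.1.symm
    · have : b = a + 1 := by
        by_contra hne
        exact hinj (a + 1) b (by omega) hb h1.1.symm
      subst this
      exact he a h.symm
  refine ⟨j - i, fun a => x (i + a), fun a => e (i + a), by omega, ?_, ?_, ?_⟩
  · intro a b hab
    have ha := a.2
    have hb := b.2
    rcases lt_trichotomy a.1 b.1 with h | h | h
    · exact absurd hab (hinj _ _ (by omega) (by omega))
    · exact Fin.ext h
    · exact absurd hab.symm (hinj _ _ (by omega) (by omega))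
  · intro a b hab
    have ha := a.2
    have hb := b.2
    rcases lt_trichotomy a.1 b.1 with h | h | h
    · exact absurd hab (heinj _ _ (by omega) (by omega) (by omega))
    · exact Fin.ext h
    · exact absurd hab.symm (heinj _ _ (by omega) (by omega) (by omega))
  · intro a
    refine ⟨heF _, ?_⟩
    obtain ⟨m, hm⟩ : ∃ m, j - i = m + 1 := ⟨j - i - 1, by omega⟩
    have key : ∀ (k : ℕ) (hk : k = m + 1) (a : Fin k),
        x (i + (finRotate k a : Fin k)) = x (i + a + 1) := by
      rintro k rfl a
      rcases Nat.lt_or_ge a.1 m with h | h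
      · have : a = ⟨a.1, by omega⟩ := rfl
        rw [this, finRotate_of_lt h]
        rfl
      · have : a = ⟨m, by omega⟩ := Fin.ext (by have := a.2; simp; omega)
        rw [this, finRotate_last']
        simp only [add_zero]
        rw [hxi]
        congr 1
        omega
    dsimp only
    rw [key _ hm a, hx]

/-- A nonempty finite multigraph without vertices of degree one contains a cycle. -/
theorem exists_cycle_of_no_leaf {V C : Type*} [Finite V] {t : C → Sym2 V} {F : Finset C}
    (hF : F.Nonempty) (h : ∀ e ∈ F, ∀ x ∈ t e, ∃ e' ∈ F, e' ≠ e ∧ x ∈ t e') :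
    ∃ k, HasCycleIn t F k := by
  have hstep : ∀ p : {p : V × C // p.2 ∈ F ∧ p.1 ∈ t p.2},
      ∃ q : {p : V × C // p.2 ∈ F ∧ p.1 ∈ t p.2},
        t p.1.2 = s(p.1.1, q.1.1) ∧ q.1.2 ≠ p.1.2 := by
    rintro ⟨⟨x, e⟩, he, hx⟩
    obtain ⟨y, hy⟩ := Sym2.mem_iff_exists.mp hx
    obtain ⟨e', he', hne, hye⟩ := h e he y (by dsimp only at hy; rw [hy]; simp)
    exact ⟨⟨(y, e'), he', hye⟩, hy, hne⟩
  choose f hf using hstep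
  obtain ⟨e0, he0⟩ := hF
  have hx0 : ∃ x0, x0 ∈ t e0 := by
    induction t e0 with
    | h a b => exact ⟨a, by simp⟩
  obtain ⟨x0, hx0⟩ := hx0
  let p : ℕ → {p : V × C // p.2 ∈ F ∧ p.1 ∈ t p.2} := fun i => f^[i] ⟨(x0, e0), he0, hx0⟩
  have hp : ∀ i, p (i + 1) = f (p i) := fun i => Function.iterate_succ_apply' f i _
  refine exists_cycle_of_walk (fun i => (p i).1.1) (fun i => (p i).1.2) (fun i => (p i).2.1) ?_ ?_
  · intro i
    rw [hp]
    exact (hf (p i)).1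
  · intro i
    rw [hp]
    exact (hf (p i)).2

/-! ### Even edge sets and averaging over the cycle space. -/

/-- The degree of the vertex `x` in the loopless multigraph with edge set `A`. -/
def edgeDegree (t : C → Sym2 V) (A : Finset C) (x : V) : ℕ := #{e ∈ A | x ∈ t e}

/-- All degrees are even. -/
def IsEvenEdgeSet (t : C → Sym2 V) (A : Finset C) : Prop := ∀ x, Even (edgeDegree t A x)

theorem card_symmDiff_parity {A B : Finset C} : Even #(symmDiff A B) ↔ (Even #A ↔ Even #B) := by
  have h1 : #(symmDiff A B) = #(A \ B) + #(B \ A) := by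
    rw [symmDiff_def, sup_eq_union, Finset.card_union_of_disjoint disjoint_sdiff_sdiff]
  have h2 := Finset.card_sdiff_add_card_inter A B
  have h3 := Finset.card_sdiff_add_card_inter B A
  rw [Finset.inter_comm] at h3
  rw [h1, Nat.even_iff, Nat.even_iff, Nat.even_iff]
  omega

theorem even_edgeDegree_symmDiff {t : C → Sym2 V} {A B : Finset C} {x : V} :
    Even (edgeDegree t (symmDiff A B) x) ↔
      (Even (edgeDegree t A x) ↔ Even (edgeDegree t B x)) := by
  rw [edgeDegree, edgeDegree, edgeDegree, ← card_symmDiff_parity]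
  congr! 2
  ext e
  simp only [mem_filter, mem_symmDiff]
  tauto

theorem IsEvenEdgeSet.symmDiff {t : C → Sym2 V} {A B : Finset C} (hA : IsEvenEdgeSet t A)
    (hB : IsEvenEdgeSet t B) : IsEvenEdgeSet t (symmDiff A B) := fun x =>
  even_edgeDegree_symmDiff.mpr (iff_of_true (hA x) (hB x))

omit [DecidableEq C] in
theorem IsEvenEdgeSet.exists_cycle [Finite V] {t : C → Sym2 V} {A : Finset C}
    (h : IsEvenEdgeSet t A) (hA : A.Nonempty) : ∃ k, HasCycleIn t A k := by
  refine exists_cycle_of_no_leaf hA fun e he x hx => ?_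
  have hmem : e ∈ ({e ∈ A | x ∈ t e} : Finset C) := by simp [he, hx]
  have h1 : 1 < #{e ∈ A | x ∈ t e} := by
    have h0 := Finset.card_pos.mpr ⟨e, hmem⟩
    have := h x
    rw [edgeDegree, Nat.even_iff] at this
    omega
  obtain ⟨e', he', hne⟩ := Finset.exists_mem_ne h1 e
  simp only [mem_filter] at he'
  exact ⟨e', he'.1, hne, he'.2⟩

omit [DecidableEq C] in
theorem sum_edgeDegree {t : C → Sym2 V} {A : Finset C} {X : Finset V}
    (hl : ∀ e ∈ A, ¬ (t e).IsDiag) (hX : ∀ e ∈ A, ∀ x ∈ t e, x ∈ X) :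
    ∑ x ∈ X, edgeDegree t A x = 2 * #A := by
  simp only [edgeDegree]
  have hdc := Finset.sum_card_bipartiteAbove_eq_sum_card_bipartiteBelow (s := X) (t := A)
    (fun x e => x ∈ t e)
  simp only [bipartiteAbove] at hdc
  rw [hdc, mul_comm]
  refine Finset.sum_const_nat fun e he => ?_
  have h1 := hl e he
  have h2 := hX e he
  have : X.bipartiteBelow (fun x e => x ∈ t e) e = (t e).toFinset := by
    ext x
    simp only [bipartiteBelow, mem_filter, Sym2.mem_toFinset]
    exact ⟨fun h => h.2, fun h => ⟨h2 x h, h⟩⟩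
  rw [this]
  exact Sym2.card_toFinset_of_not_isDiag _ h1

/-- A loopless multigraph with at least as many edges as vertices has a nonempty set of edges with
even degrees. -/
theorem exists_isEvenEdgeSet {t : C → Sym2 V} {F : Finset C} {X : Finset V}
    (hl : ∀ e ∈ F, ¬ (t e).IsDiag) (hX : ∀ e ∈ F, ∀ x ∈ t e, x ∈ X) (hF : F.Nonempty)
    (hc : #X ≤ #F) : ∃ A ⊆ F, A.Nonempty ∧ IsEvenEdgeSet t A := by
  obtain ⟨e0, he0⟩ := hF
  have hx0 : ∃ x0, x0 ∈ X := by
    have := hX e0 he0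
    induction h : t e0 with
    | h a b => exact ⟨a, this a (by rw [h]; simp)⟩
  obtain ⟨x0, hx0⟩ := hx0
  -- Ignoring `x0` leaves only `2 ^ (#X - 1)` parity patterns, so two subsets of `F` share one.
  -- Their symmetric difference is even away from `x0`, and the handshake identity settles `x0`.
  obtain ⟨S1, hS1, S2, hS2, hne, heq⟩ := Finset.exists_ne_map_eq_of_card_lt_of_maps_to
    (s := F.powerset) (t := (X.erase x0).powerset)
    (f := fun S => {x ∈ X.erase x0 | Even (edgeDegree t S x)})
    (by
      rw [card_powerset, card_powerset, card_erase_of_mem hx0]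
      have := Finset.card_pos.mpr ⟨x0, hx0⟩
      exact Nat.pow_lt_pow_right (by norm_num) (by omega))
    (fun S _ => mem_coe.mpr (mem_powerset.mpr (Finset.filter_subset _ _)))
  rw [mem_powerset] at hS1 hS2
  have hsub : symmDiff S1 S2 ⊆ F := by
    intro e he
    rw [mem_symmDiff] at he
    rcases he with he | he
    · exact hS1 he.1
    · exact hS2 he.1
  have hX' : ∀ e ∈ symmDiff S1 S2, ∀ x ∈ t e, x ∈ X := fun e he => hX e (hsub he)
  have hother : ∀ x, x ≠ x0 → Even (edgeDegree t (symmDiff S1 S2) x) := by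
    intro x hx
    by_cases hxX : x ∈ X
    · have := Finset.ext_iff.mp heq x
      simp only [mem_filter, mem_erase, hx, hxX, ne_eq, not_false_eq_true, true_and] at this
      rw [even_edgeDegree_symmDiff, this]
    · have : edgeDegree t (symmDiff S1 S2) x = 0 := by
        rw [edgeDegree, card_eq_zero, filter_eq_empty_iff]
        exact fun e he hxe => hxX (hX' e he x hxe)
      rw [this]
      exact Even.zero
  refine ⟨symmDiff S1 S2, hsub, ?_, fun x => ?_⟩
  · rw [Finset.nonempty_iff_ne_empty]
    intro h
    exact hne (symmDiff_eq_bot.mp h)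
  · by_cases hx : x = x0
    · subst hx
      have h1 := sum_edgeDegree (fun e he => hl e (hsub he)) hX'
      rw [← Finset.add_sum_erase X _ hx0] at h1
      have h2 : Even (∑ x ∈ X.erase x, edgeDegree t (symmDiff S1 S2) x) :=
        Finset.even_sum _ fun y hy => hother y (ne_of_mem_erase hy)
      rw [Nat.even_iff] at h2 ⊢
      omega
    · exact hother x hx

theorem exists_cycle_of_card_le [Finite V] {t : C → Sym2 V} {F : Finset C} {X : Finset V}
    (hl : ∀ e ∈ F, ¬ (t e).IsDiag) (hX : ∀ e ∈ F, ∀ x ∈ t e, x ∈ X) (hF : F.Nonempty)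
    (hc : #X ≤ #F) : ∃ k, HasCycleIn t F k ∧ k ≤ #X := by
  obtain ⟨A, hAF, hA, hev⟩ := exists_isEvenEdgeSet hl hX hF hc
  obtain ⟨k, hk⟩ := hev.exists_cycle hA
  exact ⟨k, hk.mono hAF, (hk.mono hAF).le_card_vertices hX⟩

/-- A shortest cycle is at most as long as any nonempty set of edges with even degrees. -/
theorem exists_shortest_cycle [Finite V] {t : C → Sym2 V} {F : Finset C} {X : Finset V}
    (hl : ∀ e ∈ F, ¬ (t e).IsDiag) (hX : ∀ e ∈ F, ∀ x ∈ t e, x ∈ X) (hF : F.Nonempty)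
    (hc : #X ≤ #F) : ∃ k, HasCycleIn t F k ∧
      ∀ A ⊆ F, A.Nonempty → IsEvenEdgeSet t A → k ≤ #A := by
  classical
  have hex : ∃ k, HasCycleIn t F k := (exists_cycle_of_card_le hl hX hF hc).imp fun k hk => hk.1
  refine ⟨Nat.find hex, Nat.find_spec hex, fun A hAF hA hev => ?_⟩
  obtain ⟨k, hk⟩ := hev.exists_cycle hA
  exact (Nat.find_min' hex (hk.mono hAF)).trans hk.le_card

theorem card_eq_sum_indicator {A F : Finset C} (h : A ⊆ F) :
    #A = ∑ e ∈ F, if e ∈ A then 1 else 0 := by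
  rw [Finset.sum_ite_mem, Finset.inter_eq_right.mpr h, Finset.card_eq_sum_ones]

theorem symmDiff_subset_of_subset {A B F : Finset C} (hA : A ⊆ F) (hB : B ⊆ F) :
    symmDiff A B ⊆ F := by
  intro e he
  rw [mem_symmDiff] at he
  rcases he with he | he
  · exact hA he.1
  · exact hB he.1

/-- Removing an edge of one even set `A` leaves room for a second one, `B`. The sets `A`, `B` and
`symmDiff A B` are nonempty and even, so each is at least as large as a shortest cycle, while every
edge lies in at most two of them. -/
theorem exists_cycle_of_card_add_one_le [Finite V] {t : C → Sym2 V} {F : Finset C} {X : Finset V}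
    (hl : ∀ e ∈ F, ¬ (t e).IsDiag) (hX : ∀ e ∈ F, ∀ x ∈ t e, x ∈ X)
    (hc : #X + 1 ≤ #F) : ∃ k, HasCycleIn t F k ∧ 3 * k ≤ 2 * #F := by
  have hF : F.Nonempty := Finset.card_pos.mp (by omega)
  obtain ⟨k, hk, hmin⟩ := exists_shortest_cycle hl hX hF (by omega)
  obtain ⟨A, hAF, ⟨a, ha⟩, hA⟩ := exists_isEvenEdgeSet hl hX hF (by omega)
  have hX0 : 0 < #X := by
    have := hk.le_card_vertices hX
    obtain ⟨_, _, h, _⟩ := hk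
    omega
  have hcard := Finset.card_erase_of_mem (hAF ha)
  have hsub := Finset.erase_subset a F
  obtain ⟨B, hBF, ⟨b, hb⟩, hB⟩ := exists_isEvenEdgeSet (F := F.erase a)
    (fun e he => hl e (hsub he)) (fun e he => hX e (hsub he))
    (Finset.card_pos.mp (by omega)) (by omega)
  have haB : a ∉ B := fun h => by simpa using hBF h
  have h1 := hmin A hAF ⟨a, ha⟩ hA
  have h2 := hmin B (hBF.trans hsub) ⟨b, hb⟩ hB
  have h3s := symmDiff_subset_of_subset hAF (hBF.trans hsub)
  have h3 := hmin (symmDiff A B) h3s ⟨a, by simp [mem_symmDiff, ha, haB]⟩ (hA.symmDiff hB)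
  refine ⟨k, hk, ?_⟩
  rw [card_eq_sum_indicator hAF] at h1
  rw [card_eq_sum_indicator (hBF.trans hsub)] at h2
  rw [card_eq_sum_indicator h3s] at h3
  have h4 : ∑ e ∈ F, ((if e ∈ A then 1 else 0) + (if e ∈ B then 1 else 0) +
      (if e ∈ symmDiff A B then 1 else 0)) ≤ ∑ e ∈ F, 2 := by
    refine Finset.sum_le_sum fun e _ => ?_
    by_cases h1 : e ∈ A <;> by_cases h2 : e ∈ B <;> simp [mem_symmDiff, h1, h2]
  rw [sum_add_distrib, sum_add_distrib, sum_const, smul_eq_mul] at h4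
  omega

/-- The same averaging over the seven nonzero combinations of three independent even sets: every
edge lies in at most four of them. -/
theorem exists_cycle_of_card_add_two_le [Finite V] {t : C → Sym2 V} {F : Finset C} {X : Finset V}
    (hl : ∀ e ∈ F, ¬ (t e).IsDiag) (hX : ∀ e ∈ F, ∀ x ∈ t e, x ∈ X)
    (hc : #X + 2 ≤ #F) : ∃ k, HasCycleIn t F k ∧ 7 * k ≤ 4 * #F := by
  have hF : F.Nonempty := Finset.card_pos.mp (by omega)
  obtain ⟨k, hk, hmin⟩ := exists_shortest_cycle hl hX hF (by omega)
  obtain ⟨A, hAF, ⟨a, ha⟩, hA⟩ := exists_isEvenEdgeSet hl hX hF (by omega)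
  have hX0 : 0 < #X := by
    have := hk.le_card_vertices hX
    obtain ⟨_, _, h, _⟩ := hk
    omega
  have hcard := Finset.card_erase_of_mem (hAF ha)
  have hsub := Finset.erase_subset a F
  obtain ⟨B, hBF, ⟨b, hb⟩, hB⟩ := exists_isEvenEdgeSet (F := F.erase a)
    (fun e he => hl e (hsub he)) (fun e he => hX e (hsub he))
    (Finset.card_pos.mp (by omega)) (by omega)
  have hcard' := Finset.card_erase_of_mem (hBF hb)
  have hsub' := (Finset.erase_subset b (F.erase a)).trans hsub
  obtain ⟨D, hDF, ⟨d, hd⟩, hD⟩ := exists_isEvenEdgeSet (F := (F.erase a).erase b)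
    (fun e he => hl e (hsub' he)) (fun e he => hX e (hsub' he))
    (Finset.card_pos.mp (by omega)) (by omega)
  have haB : a ∉ B := fun h => by simpa using hBF h
  have haD : a ∉ D := fun h => by simpa using hDF h
  have hbD : b ∉ D := fun h => by simpa using hDF h
  have hBF' := hBF.trans hsub
  have hDF' := hDF.trans hsub'
  have sAB := symmDiff_subset_of_subset hAF hBF'
  have sAD := symmDiff_subset_of_subset hAF hDF'
  have sBD := symmDiff_subset_of_subset hBF' hDF'
  have sABD := symmDiff_subset_of_subset sAB hDF'
  have h1 := hmin A hAF ⟨a, ha⟩ hA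
  have h2 := hmin B hBF' ⟨b, hb⟩ hB
  have h3 := hmin D hDF' ⟨d, hd⟩ hD
  have h4 := hmin _ sAB ⟨a, by simp [mem_symmDiff, ha, haB]⟩ (hA.symmDiff hB)
  have h5 := hmin _ sAD ⟨a, by simp [mem_symmDiff, ha, haD]⟩ (hA.symmDiff hD)
  have h6 := hmin _ sBD ⟨b, by simp [mem_symmDiff, hb, hbD]⟩ (hB.symmDiff hD)
  have h7 := hmin _ sABD ⟨a, by simp [mem_symmDiff, ha, haB, haD]⟩ ((hA.symmDiff hB).symmDiff hD)
  refine ⟨k, hk, ?_⟩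
  rw [card_eq_sum_indicator hAF] at h1
  rw [card_eq_sum_indicator hBF'] at h2
  rw [card_eq_sum_indicator hDF'] at h3
  rw [card_eq_sum_indicator sAB] at h4
  rw [card_eq_sum_indicator sAD] at h5
  rw [card_eq_sum_indicator sBD] at h6
  rw [card_eq_sum_indicator sABD] at h7
  have h8 : ∑ e ∈ F, ((if e ∈ A then 1 else 0) + (if e ∈ B then 1 else 0) +
      (if e ∈ D then 1 else 0) + (if e ∈ symmDiff A B then 1 else 0) +
      (if e ∈ symmDiff A D then 1 else 0) + (if e ∈ symmDiff B D then 1 else 0) +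
      (if e ∈ symmDiff (symmDiff A B) D then 1 else 0)) ≤ ∑ e ∈ F, 4 := by
    refine Finset.sum_le_sum fun e _ => ?_
    by_cases h1 : e ∈ A <;> by_cases h2 : e ∈ B <;> by_cases h3 : e ∈ D <;>
      simp [mem_symmDiff, h1, h2, h3]
  simp only [sum_add_distrib, sum_const, smul_eq_mul] at h8
  omega

/-! ### Sparse cores. -/

/-- The vertices of the multigraph with edge set `F`. -/
def endSet [Fintype V] (t : C → Sym2 V) (F : Finset C) : Finset V := {x | ∃ e ∈ F, x ∈ t e}

omit [DecidableEq C] in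
theorem mem_endSet [Fintype V] {t : C → Sym2 V} {F : Finset C} {x : V} :
    x ∈ endSet t F ↔ ∃ e ∈ F, x ∈ t e := by simp [endSet]

omit [DecidableEq C] in
theorem endSet_mono [Fintype V] {t : C → Sym2 V} {F F' : Finset C} (h : F ⊆ F') :
    endSet t F ⊆ endSet t F' := fun x hx => by
  rw [mem_endSet] at hx ⊢
  obtain ⟨e, he, hx⟩ := hx
  exact ⟨e, h he, hx⟩

/-- A loopless multigraph whose number of edges exceeds the number of vertices by `j` contains a
multigraph with the same property in which any `w` vertices meet at most `2 w + 2 j` edges. -/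
theorem exists_sparse_core [Fintype V] {t : C → Sym2 V} {F : Finset C} {j : ℕ}
    (hl : ∀ e ∈ F, ¬ (t e).IsDiag) (hF : F.Nonempty) (hc : #(endSet t F) + j ≤ #F) :
    ∃ F' ⊆ F, F'.Nonempty ∧ #(endSet t F') + j ≤ #F' ∧
      ∀ W : Finset V, #{e ∈ F' | ∃ x ∈ W, x ∈ t e} ≤ 2 * #W + 2 * j := by
  obtain ⟨F', hF', hmin⟩ := Finset.exists_min_image
    {F' ∈ F.powerset | F'.Nonempty ∧ #(endSet t F') + j ≤ #F'} card
    ⟨F, by simp [hF, hc]⟩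
  simp only [mem_filter, mem_powerset] at hF' hmin
  obtain ⟨hsub, hne, hcard⟩ := hF'
  have hl' : ∀ e ∈ F', ¬ (t e).IsDiag := fun e he => hl e (hsub he)
  have hends : ∀ e ∈ F', 2 ≤ #(endSet t F') := by
    intro e he
    rw [← Sym2.card_toFinset_of_not_isDiag _ (hl' e he)]
    refine Finset.card_le_card fun x hx => ?_
    rw [mem_endSet]
    exact ⟨e, he, Sym2.mem_toFinset.mp hx⟩
  have herase : ∀ e ∈ F', #F' - 1 < #(endSet t (F'.erase e)) + j := by
    intro e he
    by_contra hcon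
    have h1 := Finset.card_erase_of_mem he
    have h2 := hends e he
    have := hmin (F'.erase e) ⟨(Finset.erase_subset _ _).trans hsub,
      Finset.card_pos.mp (by omega), by omega⟩
    omega
  have heq : #(endSet t F') + j = #F' := by
    obtain ⟨e, he⟩ := hne
    have h1 := herase e he
    have h2 := Finset.card_le_card (endSet_mono (t := t) (Finset.erase_subset e F'))
    omega
  -- Deleting the edge at a vertex of degree one loses that vertex too, so the excess would survive,
  -- against minimality.
  have hdeg : ∀ x ∈ endSet t F', 2 ≤ edgeDegree t F' x := by
    intro x hx
    obtain ⟨e, he, hxe⟩ := mem_endSet.mp hx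
    by_contra hcon
    have hone : ∀ e' ∈ F', x ∈ t e' → e' = e := by
      intro e' he' hxe'
      by_contra hne
      have : 2 ≤ edgeDegree t F' x := by
        rw [← Finset.card_pair hne]
        refine Finset.card_le_card fun a ha => ?_
        simp only [mem_insert, mem_singleton] at ha
        rcases ha with rfl | rfl <;> simp [*]
      exact hcon this
    have h1 := herase e he
    have h2 : endSet t (F'.erase e) ⊆ (endSet t F').erase x := by
      intro y hy
      rw [mem_erase]
      refine ⟨?_, endSet_mono (Finset.erase_subset e F') hy⟩
      rintro rfl
      obtain ⟨e', he', hy'⟩ := mem_endSet.mp hy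
      rw [mem_erase] at he'
      exact he'.1 (hone e' he'.2 hy')
    have h3 := Finset.card_le_card h2
    rw [Finset.card_erase_of_mem hx] at h3
    have h2 := hends e he
    omega
  refine ⟨F', hsub, hne, heq.le, fun W => ?_⟩
  have hsum := sum_edgeDegree hl' (X := endSet t F') fun e he x hx => mem_endSet.mpr ⟨e, he, hx⟩
  set Y := endSet t F' with hY
  -- The degrees sum to `2 * #Y + 2 * j`, of which the vertices of `Y \ W` take at least two each.
  have h1 : #{e ∈ F' | ∃ x ∈ W, x ∈ t e} ≤ ∑ x ∈ Y ∩ W, edgeDegree t F' x := by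
    refine le_trans (Finset.card_le_card (t := (Y ∩ W).biUnion fun x => {e ∈ F' | x ∈ t e}) ?_)
      Finset.card_biUnion_le
    intro e he
    simp only [mem_filter] at he
    obtain ⟨he, x, hxW, hxe⟩ := he
    simp only [mem_biUnion, mem_inter, mem_filter]
    exact ⟨x, ⟨mem_endSet.mpr ⟨e, he, hxe⟩, hxW⟩, he, hxe⟩
  have h2 : ∑ x ∈ Y \ W, 2 ≤ ∑ x ∈ Y \ W, edgeDegree t F' x :=
    Finset.sum_le_sum fun x hx => hdeg x (Finset.mem_sdiff.mp hx).1
  have h3 := Finset.sum_inter_add_sum_sdiff Y W (fun x => edgeDegree t F' x)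
  have h4 := Finset.card_sdiff_add_card_inter Y W
  have h5 : #(Y ∩ W) ≤ #W := Finset.card_le_card Finset.inter_subset_right
  rw [sum_const, smul_eq_mul] at h2
  omega

end Multigraph

/-! ### Short closed walks in digraphs with out-degrees at least three. -/

section Digraph

open Finset

variable {V : Type*}

/-- In the digraph with out-neighbourhoods `N` there is a walk of length `l` from `a` to `b`. -/
def HasDiwalk (N : V → Finset V) : ℕ → V → V → Prop
  | 0, a, b => a = b
  | l + 1, a, b => ∃ c ∈ N a, HasDiwalk N l c b

theorem HasDiwalk.single {N : V → Finset V} {a b : V} (h : b ∈ N a) : HasDiwalk N 1 a b :=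
  ⟨b, h, rfl⟩

theorem HasDiwalk.trans {N : V → Finset V} {i j : ℕ} {a b c : V} (h : HasDiwalk N i a b)
    (h' : HasDiwalk N j b c) : HasDiwalk N (i + j) a c := by
  induction i generalizing a with
  | zero =>
    cases h
    simpa using h'
  | succ i ih =>
    obtain ⟨d, hd, h⟩ := h
    rw [Nat.add_right_comm]
    exact ⟨d, hd, ih h⟩

theorem HasDiwalk.exists_path {N : V → Finset V} {l : ℕ} {a b : V} (h : HasDiwalk N l a b) :
    ∃ p : ℕ → V, p 0 = a ∧ p l = b ∧ ∀ i < l, p (i + 1) ∈ N (p i) := by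
  induction l generalizing a with
  | zero => exact ⟨fun _ => a, rfl, h, fun i hi => by omega⟩
  | succ l ih =>
    obtain ⟨c, hc, h⟩ := h
    obtain ⟨p, h0, hl, hp⟩ := ih h
    refine ⟨fun i => Nat.casesOn i a p, rfl, hl, fun i hi => ?_⟩
    cases i with
    | zero => simpa [h0] using hc
    | succ i => exact hp i (by omega)

theorem hasDiwalk_of_path {N : V → Finset V} {p : ℕ → V} (i d : ℕ)
    (hp : ∀ a, i ≤ a → a < i + d → p (a + 1) ∈ N (p a)) : HasDiwalk N d (p i) (p (i + d)) := by
  induction d generalizing i with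
  | zero => exact rfl
  | succ d ih =>
    refine ⟨p (i + 1), hp i le_rfl (by omega), ?_⟩
    have := ih (i + 1) fun a h1 h2 => hp a (by omega) (by omega)
    rwa [show i + (d + 1) = i + 1 + d by omega]

/-- A closed walk contains a directed cycle. -/
theorem exists_dicycle_of_closed {N : V → Finset V} {m : ℕ} {a : V} (hm : 0 < m)
    (h : HasDiwalk N m a a) : ∃ k, 1 ≤ k ∧ k ≤ m ∧ ∃ u : Fin k → V, Function.Injective u ∧
      ∀ i, u (finRotate k i) ∈ N (u i) := by
  classical
  have hex : ∃ m, 0 < m ∧ ∃ a, HasDiwalk N m a a := ⟨m, hm, a, h⟩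
  obtain ⟨hk, b, hb⟩ := Nat.find_spec hex
  have hle := Nat.find_min' hex ⟨hm, a, h⟩
  have hmin : ∀ d, 0 < d → ∀ x, HasDiwalk N d x x → Nat.find hex ≤ d :=
    fun d hd x hx => Nat.find_min' hex ⟨hd, x, hx⟩
  generalize Nat.find hex = k at *
  obtain ⟨p, h0, hl, hp⟩ := hb.exists_path
  have hne : ∀ i j, i < j → j < k → p i ≠ p j := by
    intro i j hij hj heq
    have := hasDiwalk_of_path (N := N) (p := p) i (j - i) fun a _ h2 => hp a (by omega)
    rw [show i + (j - i) = j by omega, heq] at this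
    have := hmin _ (by omega) _ this
    omega
  refine ⟨k, hk, hle, fun i => p i, ?_, fun i => ?_⟩
  · intro i j hij
    rcases lt_trichotomy i.1 j.1 with h | h | h
    · exact absurd hij (hne _ _ h j.2)
    · exact Fin.ext h
    · exact absurd hij.symm (hne _ _ h i.2)
  · obtain ⟨n, rfl⟩ : ∃ n, k = n + 1 := ⟨k - 1, by omega⟩
    have hi := hp i i.2
    rcases Nat.lt_or_ge i.1 n with h | h
    · rw [show i = ⟨i.1, by omega⟩ from rfl, finRotate_of_lt h]
      exact hi
    · have hin : i.1 = n := by omega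
      rw [show i = ⟨n, by omega⟩ from Fin.ext hin, finRotate_last']
      dsimp only
      rwa [h0, ← hl, ← hin]

/-- If every vertex of a nonempty finite set has an out-neighbour in the set, then there is a
closed walk of length at most the size of the set. -/
theorem exists_closed_of_forall_exists {N : V → Finset V} {Z : Finset V} (hZ : Z.Nonempty)
    (h : ∀ z ∈ Z, ∃ y ∈ N z, y ∈ Z) : ∃ z ∈ Z, ∃ m, 0 < m ∧ m ≤ #Z ∧ HasDiwalk N m z z := by
  choose f hfN hfZ using h
  obtain ⟨z0, hz0⟩ := hZ
  let g : Z → Z := fun z => ⟨f z.1 z.2, hfZ z.1 z.2⟩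
  let p : ℕ → V := fun i => (g^[i] ⟨z0, hz0⟩).1
  have hpZ : ∀ i, p i ∈ Z := fun i => (g^[i] ⟨z0, hz0⟩).2
  have hp : ∀ i, p (i + 1) ∈ N (p i) := by
    intro i
    have : p (i + 1) = (g (g^[i] ⟨z0, hz0⟩)).1 := by
      simp only [p, Function.iterate_succ_apply']
    rw [this]
    exact hfN _ _
  have key : ∀ i j, i < j → j ≤ #Z → p i = p j →
      ∃ z ∈ Z, ∃ m, 0 < m ∧ m ≤ #Z ∧ HasDiwalk N m z z := by
    intro i j hij hj heq
    have := hasDiwalk_of_path (N := N) (p := p) i (j - i) fun a _ _ => hp a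
    rw [show i + (j - i) = j by omega, heq] at this
    exact ⟨p j, hpZ j, j - i, by omega, by omega, this⟩
  obtain ⟨i, hi, j, hj, hne, heq⟩ := Finset.exists_ne_map_eq_of_card_lt_of_maps_to
    (s := range (#Z + 1)) (t := Z) (f := p) (by simp) (fun i _ => hpZ i)
  simp only [mem_range] at hi hj
  rcases lt_or_gt_of_ne hne with h | h
  · exact key i j h (by omega) heq
  · exact key j i h (by omega) heq.symm

variable [DecidableEq V]

/-- The vertices that can be reached from `x` by a walk of length at most `i`. -/
def outBall (N : V → Finset V) (x : V) : ℕ → Finset V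
  | 0 => {x}
  | i + 1 => outBall N x i ∪ (outBall N x i).biUnion N

theorem HasDiwalk.of_mem_outBall {N : V → Finset V} {x y : V} {i : ℕ} (h : y ∈ outBall N x i) :
    ∃ l ≤ i, HasDiwalk N l x y := by
  induction i generalizing y with
  | zero =>
    simp only [outBall, mem_singleton] at h
    exact ⟨0, le_rfl, h.symm⟩
  | succ i ih =>
    simp only [outBall, mem_union, mem_biUnion] at h
    rcases h with h | ⟨z, hz, hy⟩
    · obtain ⟨l, hl, h⟩ := ih h
      exact ⟨l, by omega, h⟩
    · obtain ⟨l, hl, h⟩ := ih hz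
      exact ⟨l + 1, by omega, h.trans (.single hy)⟩

theorem outBall_subset {N : V → Finset V} {A : Finset V} (hN : ∀ a ∈ A, N a ⊆ A) {x : V}
    (hx : x ∈ A) (i : ℕ) : outBall N x i ⊆ A := by
  induction i with
  | zero => simpa [outBall] using hx
  | succ i ih =>
    rw [outBall, union_subset_iff, Finset.biUnion_subset]
    exact ⟨ih, fun z hz => hN z (ih hz)⟩

/-- If each of `n ≤ 7` vertices in the ball had an out-neighbour among them, a closed walk of length
at most 7 would arise. So one of them sends all its edges, at least three, to new vertices. -/
theorem card_add_three_le_outBall {N : V → Finset V} {A : Finset V} (hN : ∀ a ∈ A, N a ⊆ A)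
    (hcard : ∀ a ∈ A, 3 ≤ #(N a))
    (hno : ∀ a ∈ A, ∀ m, 0 < m → m ≤ 7 → ¬ HasDiwalk N m a a) {x : V} (hx : x ∈ A) {i n : ℕ}
    (hn : 0 < n) (hn7 : n ≤ 7) (h : n ≤ #(outBall N x i)) : n + 3 ≤ #(outBall N x (i + 1)) := by
  obtain ⟨Z, hZ, rfl⟩ := Finset.exists_subset_card_eq h
  have hZA := hZ.trans (outBall_subset hN hx i)
  have : ∃ z ∈ Z, Disjoint (N z) Z := by
    by_contra! hcon
    obtain ⟨z, hz, m, hm, hm', hw⟩ := exists_closed_of_forall_exists (N := N)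
      (Finset.card_pos.mp hn) (fun z hz => Finset.not_disjoint_iff.mp (hcon z hz))
    exact hno z (hZA hz) m hm (by omega) hw
  obtain ⟨z, hz, hdisj⟩ := this
  have h1 : Z ∪ N z ⊆ outBall N x (i + 1) := by
    rw [outBall]
    refine Finset.union_subset_union hZ fun y hy => ?_
    rw [mem_biUnion]
    exact ⟨z, hZ hz, hy⟩
  have h2 := Finset.card_le_card h1
  rw [Finset.card_union_of_disjoint hdisj.symm] at h2
  have := hcard z (hZA hz)
  omega

/-- Cut the walk before its first rerouted step and resume it after the last one; the two outer
pieces use only original edges. -/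
theorem HasDiwalk.of_rerouted {N : V → Finset V} {v : V} {P : V → Prop} [DecidablePred P]
    {l : ℕ} {a b : V}
    (h : HasDiwalk (fun w => if P w then insert v (N v) else N w) l a b) :
    HasDiwalk N l a b ∨ ∃ w y i j, P w ∧ y ∈ insert v (N v) ∧ HasDiwalk N i a w ∧
      HasDiwalk N j y b ∧ i + j + 1 ≤ l := by
  induction l generalizing a with
  | zero => exact Or.inl h
  | succ l ih =>
    obtain ⟨c, hc, h⟩ := h
    by_cases ha : P a
    · simp only [ha, if_true] at hc
      rcases ih h with h | ⟨w, y, i, j, hw, hy, hi, hj, hle⟩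
      · exact Or.inr ⟨a, c, 0, l, ha, hc, rfl, h, by omega⟩
      · exact Or.inr ⟨a, y, 0, j, ha, hy, rfl, hj, by omega⟩
    · simp only [ha, if_false] at hc
      rcases ih h with h | ⟨w, y, i, j, hw, hy, hi, hj, hle⟩
      · exact Or.inl ⟨c, hc, h⟩
      · exact Or.inr ⟨w, y, i + 1, j, hw, hy, ⟨c, hc, hi⟩, hj, by omega⟩

/-- A digraph on `n ≥ 1` vertices with all out-degrees at least three has a closed walk of length
at most `(4 n + 63) / 9`. -/
theorem exists_short_closed_diwalk (n : ℕ) : ∀ (N : V → Finset V) (A : Finset V), #A = n →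
    A.Nonempty → (∀ a ∈ A, N a ⊆ A) → (∀ a ∈ A, 3 ≤ #(N a)) → (∀ a ∈ A, a ∉ N a) →
    ∃ a ∈ A, ∃ m, 0 < m ∧ HasDiwalk N m a a ∧ 9 * m ≤ 4 * n + 63 := by
  induction n using Nat.strong_induction_on with
  | _ n ih =>
  intro N A hA hne hN hcard hloop
  by_contra hcon
  push Not at hcon
  have hno : ∀ a ∈ A, ∀ m, 0 < m → m ≤ 7 → ¬ HasDiwalk N m a a := by
    intro a ha m hm hm7 hw
    have := hcon a ha m hm hw
    omega
  have hball : ∀ x ∈ A, 10 ≤ #(outBall N x 3) := by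
    intro x hx
    have h0 : 1 ≤ #(outBall N x 0) := by simp [outBall]
    have h1 := card_add_three_le_outBall hN hcard hno hx (by norm_num) (by norm_num) h0
    have h2 := card_add_three_le_outBall hN hcard hno hx (by norm_num) (by norm_num) h1
    exact card_add_three_le_outBall hN hcard hno hx (by norm_num) (by norm_num) h2
  -- Out-balls of radius 3 have at least `1 + 3 + 3 + 3` vertices, so the in-balls do on average.
  have hv : ∃ v ∈ A, 10 ≤ #{x ∈ A | v ∈ outBall N x 3} := by
    by_contra! hlt
    have hdc := Finset.sum_card_bipartiteAbove_eq_sum_card_bipartiteBelow (s := A) (t := A)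
      (fun v x => v ∈ outBall N x 3)
    have h1 : ∑ v ∈ A, #(A.bipartiteAbove (fun v x => v ∈ outBall N x 3) v) < ∑ v ∈ A, 10 :=
      Finset.sum_lt_sum_of_nonempty hne fun v hv => hlt v hv
    have h2 : ∑ x ∈ A, 10 ≤ ∑ x ∈ A, #(A.bipartiteBelow (fun v x => v ∈ outBall N x 3) x) := by
      refine Finset.sum_le_sum fun x hx => ?_
      have : A.bipartiteBelow (fun v x => v ∈ outBall N x 3) x = outBall N x 3 := by
        ext y
        simp only [bipartiteBelow, mem_filter, and_iff_right_iff_imp]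
        exact fun hy => outBall_subset hN hx 3 hy
      rw [this]
      exact hball x hx
    omega
  obtain ⟨v, hvA, hv⟩ := hv
  set I : Finset V := {x ∈ A | v ∈ outBall N x 3}.erase v with hI
  have hIcard : 9 ≤ #I := by
    have : #{x ∈ A | v ∈ outBall N x 3} - 1 ≤ #I := Finset.pred_card_le_card_erase
    omega
  have hIA : I ⊆ A := (Finset.erase_subset _ _).trans (Finset.filter_subset _ _)
  have hvI : v ∉ I := by simp [hI]
  have hIw : ∀ x ∈ I, ∃ l ≤ 3, HasDiwalk N l x v := by
    intro x hx
    simp only [hI, mem_erase, mem_filter] at hx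
    exact HasDiwalk.of_mem_outBall hx.2.2
  have hNvI : ∀ x ∈ N v, x ∉ I := by
    intro x hx hxI
    obtain ⟨l, hl, hw⟩ := hIw x hxI
    exact hno v hvA (1 + l) (by omega) (by omega) ((HasDiwalk.single hx).trans hw)
  -- The set `I` will be deleted. Vertices that lose an out-neighbour are within four steps of `v`,
  -- and get `v` and its out-neighbours as new ones.
  let P : V → Prop := fun w => (N w ∩ I).Nonempty
  have hPw : ∀ w, P w → ∃ l, 0 < l ∧ l ≤ 4 ∧ HasDiwalk N l w v := by
    rintro w ⟨x, hx⟩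
    rw [mem_inter] at hx
    obtain ⟨l, hl, hw⟩ := hIw x hx.2
    exact ⟨1 + l, by omega, by omega, (HasDiwalk.single hx.1).trans hw⟩
  have hPv : ¬ P v := by
    intro h
    obtain ⟨l, h1, h2, hw⟩ := hPw v h
    exact hno v hvA l h1 (by omega) hw
  have hA' : #(A \ I) + #I = n := by
    rw [← hA]
    exact Finset.card_sdiff_add_card_eq_card hIA
  have hvA' : v ∈ A \ I := by simp [hvA, hvI]
  obtain ⟨a, haA', l, hl, hw, hle⟩ := ih #(A \ I) (by omega)
    (fun w => if P w then insert v (N v) else N w) (A \ I) rfl ⟨v, hvA'⟩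
    (by
      intro a ha
      rw [mem_sdiff] at ha
      by_cases hP : P a
      · simp only [hP, if_true]
        intro y hy
        rw [mem_insert] at hy
        rcases hy with rfl | hy
        · exact hvA'
        · exact mem_sdiff.mpr ⟨hN v hvA hy, hNvI y hy⟩
      · simp only [hP, if_false]
        exact fun y hy => mem_sdiff.mpr ⟨hN a ha.1 hy, fun h => hP ⟨y, by simp [hy, h]⟩⟩)
    (by
      intro a ha
      rw [mem_sdiff] at ha
      by_cases hP : P a
      · simp only [hP, if_true]
        exact (hcard v hvA).trans (Finset.card_le_card (Finset.subset_insert _ _))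
      · simp only [hP, if_false]
        exact hcard a ha.1)
    (by
      intro a ha
      rw [mem_sdiff] at ha
      by_cases hP : P a
      · simp only [hP, if_true, mem_insert, not_or]
        refine ⟨fun h => hPv (h ▸ hP), fun h => ?_⟩
        obtain ⟨l, h1, h2, hw⟩ := hPw a hP
        exact hno v hvA (1 + l) (by omega) (by omega) ((HasDiwalk.single h).trans hw)
      · simp only [hP, if_false]
        exact hloop a ha.1)
  have haA := (mem_sdiff.mp haA').1
  rcases hw.of_rerouted with hw | ⟨w, y, i, j, hPw', hy, hi, hj, hij⟩
  · have := hcon a haA l hl hw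
    omega
  · obtain ⟨r, hr, hr4, hwv⟩ := hPw w hPw'
    have hvy : ∃ s ≤ 1, HasDiwalk N s v y := by
      rw [mem_insert] at hy
      rcases hy with rfl | hy
      · exact ⟨0, by omega, rfl⟩
      · exact ⟨1, le_rfl, .single hy⟩
    obtain ⟨s, hs, hvy⟩ := hvy
    -- The detour through `v` makes the walk at most 4 longer, and at least 9 vertices were deleted:
    -- this is the source of the ratio 4/9.
    have := hcon a haA (i + r + s + j) (by omega) (((hi.trans hwv).trans hvy).trans hj)
    omega

end Digraph

/-! ### Transversals, killed colours and single colours. -/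

section RainbowCycle

open Finset

variable {V C : Type*}

/-- A cycle of length `k` whose edges are taken from distinct classes of the family `E`. -/
def HasRainbowCycleOf (E : C → Finset (Sym2 V)) (k : ℕ) : Prop :=
  ∃ (v : Fin k → V) (c : Fin k → C), 1 ≤ k ∧ Function.Injective v ∧ Function.Injective c ∧
    ∀ i, s(v i, v (finRotate k i)) ∈ E (c i)

theorem HasCycleIn.hasRainbowCycleOf {E : C → Finset (Sym2 V)} {t : C → Sym2 V} {F : Finset C}
    {k : ℕ} (ht : ∀ c ∈ F, t c ∈ E c) (h : HasCycleIn t F k) : HasRainbowCycleOf E k := by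
  obtain ⟨v, c, h1, h2, h3, h4⟩ := h
  exact ⟨v, c, h1, h2, h3, fun i => (h4 i).2 ▸ ht _ (h4 i).1⟩

variable [DecidableEq V]

/-- The edges of the class of `c` that avoid `W`. -/
def residualClass (E : C → Finset (Sym2 V)) (W : Finset V) (c : C) : Finset (Sym2 V) :=
  {e ∈ E c | ∀ x ∈ W, x ∉ e}

theorem mem_residualClass {E : C → Finset (Sym2 V)} {W : Finset V} {c : C} {e : Sym2 V} :
    e ∈ residualClass E W c ↔ e ∈ E c ∧ ∀ x ∈ W, x ∉ e := by simp [residualClass]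

variable [Fintype C]

/-- The colours all of whose edges have an end in `W`. -/
def killedColours (E : C → Finset (Sym2 V)) (W : Finset V) : Finset C :=
  {c | residualClass E W c = ∅}

theorem mem_killedColours {E : C → Finset (Sym2 V)} {W : Finset V} {c : C} :
    c ∈ killedColours E W ↔ ∀ e ∈ E c, ∃ x ∈ W, x ∈ e := by
  simp [killedColours, residualClass, Finset.filter_eq_empty_iff]

theorem mem_killedColours_singleton {E : C → Finset (Sym2 V)} {u : V} {c : C} :
    c ∈ killedColours E {u} ↔ ∀ e ∈ E c, u ∈ e := by
  simp [mem_killedColours]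

/-- The colours that have exactly one edge avoiding `W`. -/
def singleColours (E : C → Finset (Sym2 V)) (W : Finset V) : Finset C :=
  {c | #(residualClass E W c) = 1}

theorem singleColours_disjoint_killedColours (E : C → Finset (Sym2 V)) (W : Finset V) :
    Disjoint (singleColours E W) (killedColours E W) := by
  rw [Finset.disjoint_left]
  intro c h1 h2
  simp only [singleColours, killedColours, mem_filter, mem_univ, true_and] at h1 h2
  simp [h2] at h1

theorem card_killedColours_add_card_singleColours_le (E : C → Finset (Sym2 V)) (W : Finset V) :
    #(killedColours E W) + #(singleColours E W) ≤ Fintype.card C := by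
  classical
  rw [add_comm, ← Finset.card_union_of_disjoint (singleColours_disjoint_killedColours E W)]
  exact Finset.card_le_univ _

theorem exists_residual_transversal {E : C → Finset (Sym2 V)} (hE : ∀ c, (E c).Nonempty)
    (W : Finset V) : ∃ t : C → Sym2 V, (∀ c, t c ∈ E c) ∧
      ∀ c ∉ killedColours E W, ∀ x ∈ W, x ∉ t c := by
  have : ∀ c, ∃ e, e ∈ E c ∧ (c ∉ killedColours E W → ∀ x ∈ W, x ∉ e) := by
    intro c
    by_cases hc : c ∈ killedColours E W
    · exact (hE c).imp fun e he => ⟨he, fun h => absurd hc h⟩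
    · have h := hc
      rw [mem_killedColours] at h
      push Not at h
      obtain ⟨e, he, h⟩ := h
      exact ⟨e, he, fun _ => h⟩
  choose t ht using this
  exact ⟨t, fun c => (ht c).1, fun c => (ht c).2⟩

/-- Among the edges avoiding `Y`, choose one that has an end in `W` whenever there is one. -/
theorem exists_preferring_transversal {E : C → Finset (Sym2 V)} (W Y : Finset V)
    (hY : killedColours E Y = ∅) : ∃ t : C → Sym2 V,
      (∀ c, t c ∈ E c) ∧ (∀ c, ∀ x ∈ Y, x ∉ t c) ∧
      ∀ c, (∀ x ∈ W, x ∉ t c) → ∀ e ∈ E c, (∀ x ∈ Y, x ∉ e) → ∀ x ∈ W, x ∉ e := by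
  have : ∀ c, ∃ e, e ∈ E c ∧ (∀ x ∈ Y, x ∉ e) ∧
      ((∀ x ∈ W, x ∉ e) → ∀ e ∈ E c, (∀ x ∈ Y, x ∉ e) → ∀ x ∈ W, x ∉ e) := by
    intro c
    by_cases h : ∃ e ∈ E c, (∀ x ∈ Y, x ∉ e) ∧ ∃ x ∈ W, x ∈ e
    · obtain ⟨e, he, heY, x, hxW, hxe⟩ := h
      exact ⟨e, he, heY, fun h => absurd hxe (h x hxW)⟩
    · push Not at h
      have hc : c ∉ killedColours E Y := by simp [hY]
      rw [mem_killedColours] at hc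
      push Not at hc
      obtain ⟨e, he, heY⟩ := hc
      exact ⟨e, he, heY, fun _ => h⟩
  choose t ht using this
  exact ⟨t, fun c => (ht c).1, fun c => (ht c).2.1, fun c => (ht c).2.2⟩

variable [Fintype V] [DecidableEq C]

/-- Count the pairs of a vertex `z` outside `W` and a colour killed by `z` but not by `W`. -/
theorem mul_card_compl_le {E : C → Finset (Sym2 V)} {W : Finset V} {d : ℕ}
    (hl : ∀ c, ∀ e ∈ E c, ¬ e.IsDiag)
    (hd : ∀ z ∉ W, #(killedColours E W) + d ≤ #(killedColours E (insert z W))) :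
    d * #Wᶜ + #(killedColours E W) ≤ Fintype.card C + #(singleColours E W) := by
  have hmono : ∀ z, killedColours E W ⊆ killedColours E (insert z W) := by
    intro z c hc
    rw [mem_killedColours] at hc ⊢
    intro e he
    obtain ⟨x, hx, hxe⟩ := hc e he
    exact ⟨x, mem_insert_of_mem hx, hxe⟩
  have h1 : ∑ z ∈ Wᶜ, d ≤ ∑ z ∈ Wᶜ, #{c ∈ (killedColours E W)ᶜ | c ∈ killedColours E (insert z W)} := by
    refine Finset.sum_le_sum fun z hz => ?_
    have h1 := hd z (by simpa using hz)
    have h2 : ({c ∈ (killedColours E W)ᶜ | c ∈ killedColours E (insert z W)} : Finset C) =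
        killedColours E (insert z W) \ killedColours E W := by
      ext c
      simp only [mem_filter, mem_compl, mem_sdiff]
      tauto
    rw [h2, Finset.card_sdiff_of_subset (hmono z)]
    omega
  have hdc := Finset.sum_card_bipartiteAbove_eq_sum_card_bipartiteBelow (s := Wᶜ)
    (t := (killedColours E W)ᶜ) (fun z c => c ∈ killedColours E (insert z W))
  simp only [bipartiteAbove, bipartiteBelow] at hdc
  have h2 : ∑ c ∈ (killedColours E W)ᶜ, #{z ∈ Wᶜ | c ∈ killedColours E (insert z W)} ≤
      ∑ c ∈ (killedColours E W)ᶜ, (1 + if c ∈ singleColours E W then 1 else 0) := by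
    refine Finset.sum_le_sum fun c hc => ?_
    rw [mem_compl] at hc
    have hz : ∀ z ∈ Wᶜ, c ∈ killedColours E (insert z W) → ∀ e ∈ residualClass E W c, z ∈ e := by
      intro z _ hcz e he
      rw [mem_residualClass] at he
      obtain ⟨x, hx, hxe⟩ := mem_killedColours.mp hcz e he.1
      rcases mem_insert.mp hx with rfl | hx
      · exact hxe
      · exact absurd hxe (he.2 x hx)
    obtain ⟨e, he⟩ : (residualClass E W c).Nonempty := by
      rw [Finset.nonempty_iff_ne_empty]
      simpa [killedColours] using hc
    -- A vertex `z` that completes the killing lies on all residual edges: two choices if there is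
    -- one such edge, at most one if there are more.
    split_ifs with hs
    · refine le_trans (Finset.card_le_card fun z hz' => ?_)
        (Sym2.card_toFinset_of_not_isDiag e (hl c e (mem_residualClass.mp he).1)).le
      rw [mem_filter] at hz'
      exact Sym2.mem_toFinset.mpr (hz z hz'.1 hz'.2 e he)
    · have h1 : 1 < #(residualClass E W c) := by
        have := Finset.card_pos.mpr ⟨e, he⟩
        simp only [singleColours, mem_filter, mem_univ, true_and] at hs
        omega
      obtain ⟨f, hf, hfe⟩ := Finset.exists_mem_ne h1 e
      rw [add_zero, Finset.card_le_one]
      intro x hx y hy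
      rw [mem_filter] at hx hy
      by_contra hxy
      exact hfe (Sym2.eq_of_ne_mem hxy (hz x hx.1 hx.2 f hf) (hz y hy.1 hy.2 f hf)
        (hz x hx.1 hx.2 e he) (hz y hy.1 hy.2 e he))
  rw [sum_add_distrib, sum_const, smul_eq_mul, mul_one, Finset.sum_ite_mem, sum_const,
    smul_eq_mul, mul_one] at h2
  have h3 : #((killedColours E W)ᶜ ∩ singleColours E W) ≤ #(singleColours E W) :=
    Finset.card_le_card Finset.inter_subset_right
  rw [sum_const, smul_eq_mul, mul_comm] at h1
  have h4 := Finset.card_compl_add_card (killedColours E W)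
  omega

/-! ### The three cases. -/

section

variable {E : C → Finset (Sym2 V)}

omit [DecidableEq C] in
theorem killedColours_univ : killedColours E univ = univ := by
  ext c
  simp only [mem_killedColours, mem_univ, true_and, iff_true]
  intro e _
  induction e with
  | h a b => exact ⟨a, by simp⟩

theorem exists_rainbow_of_card_le (hE : ∀ c, (E c).Nonempty) (hl : ∀ c, ∀ e ∈ E c, ¬ e.IsDiag)
    (hcard : Fintype.card C = Fintype.card V) {W : Finset V}
    (hW : #(killedColours E W) ≤ #W) (hpos : #(killedColours E W) < Fintype.card C) :
    ∃ k, HasRainbowCycleOf E k ∧ k ≤ #Wᶜ := by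
  obtain ⟨t, ht, htW⟩ := exists_residual_transversal hE W
  have h1 := Finset.card_compl_add_card (killedColours E W)
  have h2 := Finset.card_compl_add_card W
  obtain ⟨k, hk, hle⟩ := exists_cycle_of_card_le (t := t) (F := (killedColours E W)ᶜ) (X := Wᶜ)
    (fun c _ => hl c _ (ht c))
    (fun c hc x hx => mem_compl.mpr fun hxW => htW c (mem_compl.mp hc) x hxW hx)
    (Finset.card_pos.mp (by omega)) (by omega)
  exact ⟨k, hk.hasRainbowCycleOf fun c _ => ht c, hle⟩

theorem exists_rainbow_of_card_add_one_le (hE : ∀ c, (E c).Nonempty)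
    (hl : ∀ c, ∀ e ∈ E c, ¬ e.IsDiag) (hcard : Fintype.card C = Fintype.card V) {W : Finset V}
    (hW : #(killedColours E W) + 1 ≤ #W) :
    ∃ k, HasRainbowCycleOf E k ∧ 3 * k + 2 * #(killedColours E W) ≤ 2 * Fintype.card C := by
  obtain ⟨t, ht, htW⟩ := exists_residual_transversal hE W
  have h1 := Finset.card_compl_add_card (killedColours E W)
  have h2 := Finset.card_compl_add_card W
  obtain ⟨k, hk, hle⟩ := exists_cycle_of_card_add_one_le (t := t) (F := (killedColours E W)ᶜ)
    (X := Wᶜ) (fun c _ => hl c _ (ht c))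
    (fun c hc x hx => mem_compl.mpr fun hxW => htW c (mem_compl.mp hc) x hxW hx) (by omega)
  exact ⟨k, hk.hasRainbowCycleOf fun c _ => ht c, by omega⟩

theorem exists_rainbow_of_card_add_two_le (hE : ∀ c, (E c).Nonempty)
    (hl : ∀ c, ∀ e ∈ E c, ¬ e.IsDiag) (hcard : Fintype.card C = Fintype.card V) {W : Finset V}
    (hW : #(killedColours E W) + 2 ≤ #W) :
    ∃ k, HasRainbowCycleOf E k ∧ 7 * k + 4 * #(killedColours E W) ≤ 4 * Fintype.card C := by
  obtain ⟨t, ht, htW⟩ := exists_residual_transversal hE W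
  have h1 := Finset.card_compl_add_card (killedColours E W)
  have h2 := Finset.card_compl_add_card W
  obtain ⟨k, hk, hle⟩ := exists_cycle_of_card_add_two_le (t := t) (F := (killedColours E W)ᶜ)
    (X := Wᶜ) (fun c _ => hl c _ (ht c))
    (fun c hc x hx => mem_compl.mpr fun hxW => htW c (mem_compl.mp hc) x hxW hx) (by omega)
  exact ⟨k, hk.hasRainbowCycleOf fun c _ => ht c, by omega⟩

/-- The sparse core of a transversal most of whose edges meet `W` is small. -/
theorem exists_small_core {t : C → Sym2 V} (hl : ∀ c, ¬ (t c).IsDiag) (hC : 0 < Fintype.card C)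
    {j : ℕ} (hj : #(endSet t univ) + j ≤ Fintype.card C) (W : Finset V) :
    ∃ F : Finset C, F.Nonempty ∧ #(endSet t F) + j ≤ #F ∧
      #F ≤ 2 * #W + 2 * j + #{c | ∀ x ∈ W, x ∉ t c} := by
  obtain ⟨F, -, hF, hcard, hW⟩ := exists_sparse_core (t := t) (F := univ) (j := j)
    (fun c _ => hl c) (Finset.card_pos.mp hC) (by simpa using hj)
  refine ⟨F, hF, hcard, ?_⟩
  have h1 := Finset.card_filter_add_card_filter_not (s := F) (fun c => ∃ x ∈ W, x ∈ t c)
  have h2 : #{c ∈ F | ¬ ∃ x ∈ W, x ∈ t c} ≤ #{c | ∀ x ∈ W, x ∉ t c} := by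
    refine Finset.card_le_card fun c hc => ?_
    simpa using (mem_filter.mp hc).2
  have h3 := hW W
  omega

/-- Take `W` as large as possible with deficiency `s ≥ 2`; each further vertex then kills at least
`s` more colours. For `s ≥ 3` the count leaves at most 6 vertices outside `W`. For `s = 2` it leaves
at most 4 colours with several edges off `W`, and the size of `W` decides which transversal to use.
-/
theorem exists_rainbow_of_two_le_deficiency (hE : ∀ c, #(E c) = 3)
    (hl : ∀ c, ∀ e ∈ E c, ¬ e.IsDiag) (hcard : Fintype.card C = Fintype.card V)
    {W₀ : Finset V} (hW₀ : #(killedColours E W₀) + 2 ≤ #W₀) :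
    ∃ k, HasRainbowCycleOf E k ∧ 9 * k ≤ 4 * Fintype.card C + 63 := by
  have hE' : ∀ c, (E c).Nonempty := fun c => Finset.card_pos.mp (by rw [hE]; norm_num)
  obtain ⟨W, hW, hmax⟩ := Finset.exists_max_image
    {W : Finset V | #(killedColours E W) + 2 ≤ #W} card ⟨W₀, by simpa using hW₀⟩
  simp only [mem_filter, mem_univ, true_and] at hW hmax
  obtain ⟨s, hs⟩ : ∃ s, #W = #(killedColours E W) + s := ⟨_, (Nat.add_sub_of_le (by omega)).symm⟩
  have hcompl := Finset.card_compl_add_card W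
  have hcount := mul_card_compl_le (W := W) (d := s) hl (by
    intro z hz
    by_contra hlt
    have hins := Finset.card_insert_of_notMem hz
    have := hmax (insert z W) (by omega)
    omega)
  have hsing := card_killedColours_add_card_singleColours_le E W
  have hpos : #(killedColours E W) < Fintype.card C := by
    have h2 : #W ≠ Fintype.card V := by
      intro h
      have : W = univ := by rwa [← Finset.card_eq_iff_eq_univ]
      subst this
      rw [killedColours_univ] at hW
      simp only [Finset.card_univ] at hW
      omega
    omega
  rcases Nat.lt_or_ge 2 s with h3 | h2
  · obtain ⟨k, hk, hle⟩ := exists_rainbow_of_card_le hE' hl hcard (W := W) (by omega) hpos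
    refine ⟨k, hk, ?_⟩
    have : #Wᶜ ≤ 6 := by
      obtain ⟨r, rfl⟩ : ∃ r, s = r + 3 := ⟨s - 3, by omega⟩
      by_contra hlt
      push Not at hlt
      have : (r + 3) * #Wᶜ ≤ 2 * #Wᶜ + 2 * (r + 3) := by omega
      nlinarith
    omega
  · obtain rfl : s = 2 := by omega
    by_cases hsize : 18 * #W ≤ 4 * Fintype.card C + 27
    · have hempty : killedColours E ∅ = ∅ := by
        ext c
        simp only [mem_killedColours, notMem_empty, false_and, exists_false, imp_false, iff_false]
        intro h
        obtain ⟨e, he⟩ := hE' c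
        exact h e he
      obtain ⟨t, ht, -, htW⟩ := exists_preferring_transversal (E := E) W ∅ hempty
      obtain ⟨F, hF, hFc, hFle⟩ := exists_small_core (t := t) (j := 0) (fun c => hl c _ (ht c))
        (by omega) (by rw [hcard]; exact Finset.card_le_univ _) W
      obtain ⟨k, hk, -⟩ := exists_cycle_of_card_le (t := t) (F := F) (X := endSet t F)
        (fun c _ => hl c _ (ht c)) (fun c hc x hx => mem_endSet.mpr ⟨c, hc, hx⟩) hF (by omega)
      refine ⟨k, hk.hasRainbowCycleOf fun c _ => ht c, ?_⟩
      -- A colour whose preferred edge misses `W` has all three edges off `W`, so it is neither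
      -- killed nor single.
      have hexc : #{c | ∀ x ∈ W, x ∉ t c} ≤ #(killedColours E W ∪ singleColours E W)ᶜ := by
        refine Finset.card_le_card fun c hc => ?_
        simp only [mem_filter, mem_univ, true_and] at hc
        have : residualClass E W c = E c := by
          ext e
          rw [mem_residualClass]
          exact ⟨And.left, fun he => ⟨he, htW c hc e he (by simp)⟩⟩
        have h3 := hE c
        simp only [mem_compl, mem_union, killedColours, singleColours, mem_filter, mem_univ,
          true_and, this, not_or]
        refine ⟨fun h => ?_, by omega⟩
        rw [h] at h3
        simp at h3
      rw [Finset.card_compl, Finset.card_union_of_disjoint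
        (singleColours_disjoint_killedColours E W).symm] at hexc
      have := hk.le_card
      omega
    · obtain ⟨k, hk, hle⟩ := exists_rainbow_of_card_add_two_le hE' hl hcard hW
      exact ⟨k, hk, by omega⟩

/-- Some vertex that is the centre of no colour meets few colours in at least two but not all
edges. -/
theorem exists_vertex_few_exceptions (hE : ∀ c, #(E c) = 3)
    (hcard : Fintype.card C = Fintype.card V) {u₀ : V} (hu₀ : killedColours E {u₀} = ∅) :
    ∃ u, killedColours E {u} = ∅ ∧
      #{c | 2 ≤ #{e ∈ E c | u ∈ e} ∧ ∃ e ∈ E c, u ∉ e} ≤ 6 := by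
  set U : Finset V := {u | killedColours E {u} = ∅} with hU
  set S : Finset C := {c | ∃ z, ∀ e ∈ E c, z ∈ e} with hS
  have hcentre : ∀ c x y, x ≠ y → 2 ≤ #{e ∈ E c | y ∈ e} → ¬ ∀ e ∈ E c, x ∈ e := by
    intro c x y hxy h2 hx
    obtain ⟨e, he, f, hf, hne⟩ := Finset.one_lt_card.mp h2
    rw [mem_filter] at he hf
    exact hne (Sym2.eq_of_ne_mem hxy (hx e he.1) he.2 (hx f hf.1) hf.2)
  have hSU : #Uᶜ ≤ #S := by
    have : ∀ v : V, ∃ c, v ∈ Uᶜ → ∀ e ∈ E c, v ∈ e := by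
      intro v
      by_cases hv : v ∈ Uᶜ
      · simp only [hU, mem_compl, mem_filter, mem_univ, true_and] at hv
        obtain ⟨c, hc⟩ := Finset.nonempty_iff_ne_empty.mpr hv
        exact ⟨c, fun _ => mem_killedColours_singleton.mp hc⟩
      · have : Nonempty C := by
          rw [← Fintype.card_pos_iff, hcard]
          exact Fintype.card_pos_iff.mpr ⟨v⟩
        exact ⟨Classical.arbitrary C, fun h => absurd h hv⟩
    choose f hf using this
    refine Finset.card_le_card_of_injOn f (fun v hv => ?_) fun v hv w hw heq => ?_
    · simp only [hS, coe_filter, mem_univ, true_and, Set.mem_ofPred_eq]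
      exact ⟨v, hf v hv⟩
    · by_contra hne
      refine hcentre (f v) v w hne ?_ (hf v hv)
      rw [heq, Finset.filter_true_of_mem (hf w hw), hE]
      norm_num
  have h1 := Finset.card_compl_add_card U
  have h2 := Finset.card_compl_add_card S
  -- There are at most `#U` classes without a centre, each covering at most six vertices, so some
  -- vertex of `U` meets at most six of them.
  have hu : ∃ u ∈ U, #{c ∈ Sᶜ | ∃ e ∈ E c, u ∈ e} ≤ 6 := by
    by_contra! hlt
    have hdc := Finset.sum_card_bipartiteAbove_eq_sum_card_bipartiteBelow (s := U) (t := Sᶜ)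
      (fun u c => ∃ e ∈ E c, u ∈ e)
    simp only [bipartiteAbove, bipartiteBelow] at hdc
    have h3 : ∑ u ∈ U, 6 < ∑ u ∈ U, #{c ∈ Sᶜ | ∃ e ∈ E c, u ∈ e} :=
      Finset.sum_lt_sum_of_nonempty ⟨u₀, by simpa [hU] using hu₀⟩ fun u hu => hlt u hu
    have h4 : ∑ c ∈ Sᶜ, #{u ∈ U | ∃ e ∈ E c, u ∈ e} ≤ ∑ c ∈ Sᶜ, 6 := by
      refine Finset.sum_le_sum fun c _ => ?_
      have h5 : ({u ∈ U | ∃ e ∈ E c, u ∈ e} : Finset V) ⊆ (E c).biUnion Sym2.toFinset := by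
        intro u hu
        obtain ⟨e, he, hue⟩ := (mem_filter.mp hu).2
        exact mem_biUnion.mpr ⟨e, he, Sym2.mem_toFinset.mpr hue⟩
      refine (Finset.card_le_card h5).trans (Finset.card_biUnion_le.trans ?_)
      refine (Finset.sum_le_card_nsmul _ _ 2 fun e _ => ?_).trans (by simp [hE])
      rw [Sym2.card_toFinset]
      split_ifs <;> norm_num
    simp only [sum_const, smul_eq_mul] at h3 h4
    omega
  obtain ⟨u, huU, hu6⟩ := hu
  refine ⟨u, by simpa [hU] using huU, le_trans (Finset.card_le_card fun c hc => ?_) hu6⟩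
  simp only [mem_filter, mem_univ, true_and] at hc
  obtain ⟨hc2, f, hf, hfu⟩ := hc
  simp only [hS, mem_filter, mem_compl, mem_univ, true_and, not_exists]
  refine ⟨fun z hz => ?_, ?_⟩
  · by_cases hzu : z = u
    · exact hfu (hzu ▸ hz f hf)
    · exact hcentre c z u hzu hc2 hz
  · obtain ⟨e, he⟩ := Finset.card_pos.mp (by omega : 0 < #{e ∈ E c | u ∈ e})
    rw [mem_filter] at he
    exact ⟨e, he⟩

/-- Take `W` maximal of deficiency 1 containing `u`. One transversal avoids `W`. The other avoids
only `u`, which gives it excess 1, and prefers edges meeting `W.erase u`. The shorter of the two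
cycles is short enough. -/
theorem exists_rainbow_of_deficiency_le_one (hE : ∀ c, #(E c) = 3)
    (hl : ∀ c, ∀ e ∈ E c, ¬ e.IsDiag) (hcard : Fintype.card C = Fintype.card V)
    (hdef : ∀ W : Finset V, #W ≤ #(killedColours E W) + 1) {u₀ : V}
    (hu₀ : killedColours E {u₀} = ∅) :
    ∃ k, HasRainbowCycleOf E k ∧ 9 * k ≤ 4 * Fintype.card C + 63 := by
  have hE' : ∀ c, (E c).Nonempty := fun c => Finset.card_pos.mp (by rw [hE]; norm_num)
  obtain ⟨u, hu, hex⟩ := exists_vertex_few_exceptions hE hcard hu₀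
  obtain ⟨W, hW, hmax⟩ := Finset.exists_max_image
    {W : Finset V | u ∈ W ∧ #(killedColours E W) + 1 ≤ #W} card ⟨{u}, by simp [hu]⟩
  simp only [mem_filter, mem_univ, true_and] at hW hmax
  obtain ⟨huW, hW⟩ := hW
  have hWd := hdef W
  have hcompl := Finset.card_compl_add_card W
  have hcount := mul_card_compl_le (W := W) (d := 2) hl (by
    intro z hz
    by_contra hlt
    have hins := Finset.card_insert_of_notMem hz
    have := hmax (insert z W) ⟨mem_insert_of_mem huW, by omega⟩
    omega)
  have hsing := card_killedColours_add_card_singleColours_le E W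
  have hVpos : 0 < Fintype.card V := Fintype.card_pos_iff.mpr ⟨u⟩
  have hWu := Finset.card_erase_of_mem huW
  have hWpos := Finset.card_pos.mpr ⟨u, huW⟩
  obtain ⟨k₁, hk₁, hle₁⟩ := exists_rainbow_of_card_add_one_le hE' hl hcard hW
  obtain ⟨t, ht, htu, htW⟩ := exists_preferring_transversal (E := E) (W.erase u) {u} hu
  have hends : endSet t univ ⊆ univ.erase u := by
    intro x hx
    obtain ⟨c, -, hxc⟩ := mem_endSet.mp hx
    rw [mem_erase]
    refine ⟨?_, mem_univ _⟩
    rintro rfl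
    exact htu c x (by simp) hxc
  have hends' := Finset.card_le_card hends
  rw [Finset.card_erase_of_mem (mem_univ _), Finset.card_univ] at hends'
  obtain ⟨F, hF, hFc, hFle⟩ := exists_small_core (t := t) (j := 1) (fun c => hl c _ (ht c))
    (by omega) (by omega) (W.erase u)
  obtain ⟨k₂, hk₂, hle₂⟩ := exists_cycle_of_card_add_one_le (t := t) (F := F) (X := endSet t F)
    (fun c _ => hl c _ (ht c)) (fun c hc x hx => mem_endSet.mpr ⟨c, hc, hx⟩) (by omega)
  replace hk₂ := hk₂.hasRainbowCycleOf (E := E) fun c _ => ht c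
  have hexc : #{c | ∀ x ∈ W.erase u, x ∉ t c} ≤
      #((killedColours E W ∪ singleColours E W)ᶜ ∪
        ({c | 2 ≤ #{e ∈ E c | u ∈ e} ∧ ∃ e ∈ E c, u ∉ e} : Finset C)) := by
    refine Finset.card_le_card fun c hc => ?_
    simp only [mem_filter, mem_univ, true_and] at hc
    have hres : residualClass E W c = {e ∈ E c | ¬ u ∈ e} := by
      ext e
      rw [mem_residualClass, mem_filter]
      refine and_congr_right fun he => ⟨fun h => h u huW, fun h x hx => ?_⟩
      by_cases hxu : x = u
      · rwa [hxu]
      · exact htW c hc e he (by simpa using h) x (mem_erase.mpr ⟨hxu, hx⟩)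
    have htmem : t c ∈ residualClass E W c := by
      rw [hres, mem_filter]
      exact ⟨ht c, htu c u (by simp)⟩
    have hsplit := Finset.card_filter_add_card_filter_not (s := E c) (fun e => u ∈ e)
    rw [← hres, hE] at hsplit
    rw [mem_union]
    -- A single colour here has its other two edges at `u`, so it is among the at most six
    -- exceptions for `u`; at most two colours are neither killed nor single.
    by_cases hone : #(residualClass E W c) = 1
    · right
      simp only [mem_filter, mem_univ, true_and]
      exact ⟨by omega, t c, ht c, htu c u (by simp)⟩
    · left
      simp only [mem_compl, mem_union, killedColours, singleColours, mem_filter, mem_univ,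
        true_and, not_or]
      exact ⟨Finset.ne_empty_of_mem htmem, hone⟩
  replace hexc := hexc.trans (Finset.card_union_le _ _)
  rw [Finset.card_compl, Finset.card_union_of_disjoint
    (singleColours_disjoint_killedColours E W).symm] at hexc
  -- Up to constants, `3 * k₁ ≤ 2 * (n - #W)` and `3 * k₂ ≤ 4 * #W`; twice the first plus the second
  -- eliminates `#W`.
  rcases le_total k₁ k₂ with h | h
  · exact ⟨k₁, hk₁, by omega⟩
  · exact ⟨k₂, hk₂, by omega⟩

-- Distinct vertices are centres of distinct colours, since two edges sharing two vertices coincide.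
-- Hence a directed cycle in the digraph of outward stars is rainbow.
omit [Fintype C] [DecidableEq C] in
theorem exists_rainbow_of_forall_centre (hE : ∀ c, #(E c) = 3)
    (hl : ∀ c, ∀ e ∈ E c, ¬ e.IsDiag) [Nonempty V]
    (hcentre : ∀ v, ∃ c, ∀ e ∈ E c, v ∈ e) :
    ∃ k, HasRainbowCycleOf E k ∧ 9 * k ≤ 4 * Fintype.card V + 63 := by
  choose f hf using hcentre
  have hinj : Function.Injective f := by
    intro v w hvw
    by_contra hne
    have h1 : 1 < #(E (f v)) := by rw [hE]; norm_num
    obtain ⟨e, he, e', he', hee⟩ := Finset.one_lt_card.mp h1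
    exact hee (Sym2.eq_of_ne_mem hne (hf v e he) (hf w e (hvw ▸ he)) (hf v e' he')
      (hf w e' (hvw ▸ he')))
  let N : V → Finset V := fun v => {y | s(v, y) ∈ E (f v)}
  obtain ⟨a, -, m, hm, hw, hle⟩ := exists_short_closed_diwalk (Fintype.card V) N univ
    (Finset.card_univ) Finset.univ_nonempty (fun _ _ => Finset.subset_univ _)
    (by
      intro v _
      rw [← hE (f v)]
      have : E (f v) ⊆ (N v).image fun y => s(v, y) := by
        intro e he
        obtain ⟨y, rfl⟩ := Sym2.mem_iff_exists.mp (hf v e he)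
        exact mem_image.mpr ⟨y, by simpa [N] using he, rfl⟩
      exact (Finset.card_le_card this).trans Finset.card_image_le)
    (by
      intro v _ hv
      simp only [N, mem_filter, mem_univ, true_and] at hv
      exact hl _ _ hv (Sym2.mk_isDiag_iff.mpr rfl))
  obtain ⟨k, hk1, hkm, u, hu, huN⟩ := exists_dicycle_of_closed hm hw
  refine ⟨k, ⟨u, f ∘ u, hk1, hu, hinj.comp hu, fun i => ?_⟩, by omega⟩
  simpa [N] using huN i

/-- A loopless family of as many three-edge classes as vertices has a short rainbow cycle. -/
theorem exists_short_rainbowCycleOf (hE : ∀ c, #(E c) = 3)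
    (hl : ∀ c, ∀ e ∈ E c, ¬ e.IsDiag) (hcard : Fintype.card C = Fintype.card V) [Nonempty V] :
    ∃ k, HasRainbowCycleOf E k ∧ 9 * k ≤ 4 * Fintype.card V + 63 := by
  by_cases hA : ∃ W, #(killedColours E W) + 2 ≤ #W
  · obtain ⟨W, hW⟩ := hA
    rw [← hcard]
    exact exists_rainbow_of_two_le_deficiency hE hl hcard hW
  · push Not at hA
    by_cases hB : ∃ u, killedColours E {u} = ∅
    · obtain ⟨u, hu⟩ := hB
      rw [← hcard]
      exact exists_rainbow_of_deficiency_le_one hE hl hcard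
        (fun W => by have := hA W; omega) hu
    · push Not at hB
      refine exists_rainbow_of_forall_centre hE hl fun v => ?_
      obtain ⟨c, hc⟩ := hB v
      exact ⟨c, mem_killedColours_singleton.mp hc⟩

end

end RainbowCycle

/-! ### Reduction of coloured multigraphs to families of three-edge classes. -/

theorem theorem3p1 {α β γ : Type*} [Fintype γ] (G : Graph α β) (c : β → γ) (n : ℕ)
    (hn : 1 ≤ n)
    (hV : G.vertexSet.encard = n)
    (hcol : n ≤ Fintype.card γ)
    (hsimple : G.IsSimpleEdgeColoured c)
    (hclass : ∀ i : γ, 3 ≤ (G.colourClass c i).encard) :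
    ∃ k : ℕ, G.HasRainbowCycle c k ∧ (k : ℝ) ≤ 4 * (n : ℝ) / 9 + 7 := by
  classical
  by_cases hloop : ∃ e x, G.IsLink e x x
  · obtain ⟨e, x, he⟩ := hloop
    refine ⟨1, ⟨fun _ => x, fun _ => e, ⟨le_rfl, Function.injective_of_subsingleton _,
      Function.injective_of_subsingleton _, fun _ => he⟩, ?_⟩, ?_⟩
    · rintro _ ⟨i, rfl⟩ _ ⟨j, rfl⟩ _
      rfl
    · have : (0 : ℝ) ≤ n := Nat.cast_nonneg n
      push_cast
      linarith
  have hfin : G.vertexSet.Finite := Set.finite_of_encard_eq_coe hV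
  let _ : Fintype G.vertexSet := hfin.fintype
  have hcardV : Fintype.card G.vertexSet = n := by
    have h1 := Set.encard_eq_coe_toFinset_card G.vertexSet
    rw [hV, Set.toFinset_card] at h1
    exact_mod_cast h1.symm
  have : Nonempty G.vertexSet := Fintype.card_pos_iff.mp (by omega)
  obtain ⟨g⟩ : Nonempty (Fin n ↪ γ) := Function.Embedding.nonempty_of_card_le (by simpa using hcol)
  have hT : ∀ i : γ, ∃ T : Finset β, (∀ e ∈ T, e ∈ G.colourClass c i) ∧ T.card = 3 := by
    intro i
    obtain ⟨T, hT, hT3⟩ := Set.exists_subset_encard_eq (hclass i)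
    have hTfin : T.Finite := Set.finite_of_encard_eq_coe (k := 3) hT3
    refine ⟨hTfin.toFinset, fun e he => hT (hTfin.mem_toFinset.mp he), ?_⟩
    rw [hTfin.encard_eq_coe_toFinset_card] at hT3
    exact_mod_cast hT3
  choose T hTc hT3 using hT
  have hends : ∀ e, ∃ p : Sym2 G.vertexSet, e ∈ G.edgeSet →
      ∀ x y : G.vertexSet, p = s(x, y) → G.IsLink e x y := by
    intro e
    by_cases he : e ∈ G.edgeSet
    · obtain ⟨x, y, hxy⟩ := Graph.exists_isLink_of_mem_edgeSet he
      refine ⟨s(⟨x, hxy.left_mem⟩, ⟨y, hxy.right_mem⟩), fun _ a b hab => ?_⟩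
      rw [Sym2.eq_iff] at hab
      rcases hab with ⟨rfl, rfl⟩ | ⟨rfl, rfl⟩
      · exact hxy
      · exact hxy.symm
    · exact ⟨s(Classical.arbitrary _, Classical.arbitrary _), fun h => absurd h he⟩
  choose p hp using hends
  have hlink : ∀ e ∈ G.edgeSet, ∃ x y : G.vertexSet, p e = s(x, y) ∧ G.IsLink e x y := by
    intro e he
    obtain ⟨x, y, hxy⟩ : ∃ x y, p e = s(x, y) := by
      induction p e with
      | h x y => exact ⟨x, y, rfl⟩
    exact ⟨x, y, hxy, hp e he x y hxy⟩
  obtain ⟨k, ⟨v, d, hk, hv, hd, hvd⟩, hle⟩ := exists_short_rainbowCycleOf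
    (E := fun i : Fin n => (T (g i)).image p)
    (by
      intro i
      -- Simplicity makes the passage from edges to unordered pairs of ends injective on each class.
      rw [Finset.card_image_of_injOn, hT3]
      intro e he f hf hef
      have hec := hTc _ e he
      have hfc := hTc _ f hf
      obtain ⟨x, y, hxy, hl⟩ := hlink e hec.1
      exact hsimple _ e hec f hfc x y hl (hp f hfc.1 x y (hef.symm.trans hxy)))
    (by
      intro i q hq hdiag
      obtain ⟨e, he, rfl⟩ := Finset.mem_image.mp hq
      obtain ⟨x, y, hxy, hl⟩ := hlink e (hTc _ e he).1
      rw [hxy, Sym2.mk_isDiag_iff] at hdiag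
      subst hdiag
      exact hloop ⟨e, x, hl⟩)
    (by simp [hcardV])
  rw [hcardV] at hle
  simp only [Finset.mem_image] at hvd
  choose e heT he using hvd
  have hce : ∀ i, c (e i) = g (d i) := fun i => (hTc _ _ (heT i)).2
  have hcol_inj : ∀ i j, c (e i) = c (e j) → i = j := fun i j h =>
    hd (g.injective (by rw [← hce, ← hce, h]))
  refine ⟨k, ⟨fun i => v i, e, ⟨hk, Subtype.val_injective.comp hv,
    fun i j h => hcol_inj i j (by rw [h]), fun i => hp _ (hTc _ _ (heT i)).1 _ _ (he i)⟩, ?_⟩, ?_⟩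
  · rintro _ ⟨i, rfl⟩ _ ⟨j, rfl⟩ h
    rw [hcol_inj i j h]
  · have : (9 : ℝ) * k ≤ 4 * n + 63 := by exact_mod_cast hle
    linarith
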